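/- Let $X \in \mathbb{C}^{n\times n}$ have no eigenvalues on $(-\infty,0]$, and let $R = X^{1/2}$ be its principal square root, i.e. the matrix obtained by applying the principal branch of the scalar square root to $X$ through the holomorphic functional calculus, $$R=\frac{1}{2\pi i}\oint_\gamma z^{1/2}\,(z-X)^{-1}\,dz,$$ where $\gamma$ is a positively oriented contour that encloses the spectrum of $X$ and lies in $\mathbb{C}\setminus(-\infty,0]$ (for instance the union of small disjoint circles around the distinct eigenvalues of $X$). Then the following are all true. 1. If $X$ is unitary, then $R$ is unitary. 2. If $X$ is complex symmetric ($X^{\top}=X$), then $R$ is complex symmetric. 3. If all entries of $X$ are real, then all entries of $R$ are real. 4. If $n=2m$ is even and $X$ is self-dual, i.e. $X^{\sharp}=X$ for $X^{\sharp}=-ZX^{\top}Z$ with $Z=\begin{pmatrix}0&I_m\\-I_m&0\end{pmatrix}$, then $R$ is self-dual. 5. If $\Gamma\in\mathbb{C}^{n\times n}$ is unitary with $\Gamma^2=I$ and $\Gamma X\Gamma=X^{\dagger}$, where $\dagger$ denotes the conjugate transpose, then $\Gamma R\Gamma=R^{\dagger}$. -/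

import Mathlib

noncomputable section

namespace RootSymmetry

/-- The finite set of (distinct) eigenvalues of a complex matrix. -/
def eigenvalueSet {n : ℕ} (X : Matrix (Fin n) (Fin n) ℂ) : Finset ℂ :=
  X.charpoly.roots.toFinset

/-- `X` has no eigenvalue on `(-∞, 0]`. -/
def NoNonposEigenvalue {n : ℕ} (X : Matrix (Fin n) (Fin n) ℂ) : Prop :=
  ∀ t : ℝ, t ≤ 0 → ¬ Module.End.HasEigenvalue (Matrix.toLin' X) (t : ℂ)

/-- One third of the distance from `μ` to the other eigenvalues of `X` and to the half line
`(-∞, 0]` (which is the complement of `Complex.slitPlane`).  For the eigenvalues of a matrix without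
eigenvalues on `(-∞, 0]`, the closed discs with these radii are nondegenerate, pairwise disjoint
and contained in the slit plane. -/
def contourRadius {n : ℕ} (X : Matrix (Fin n) (Fin n) ℂ) (μ : ℂ) : ℝ :=
  Metric.infDist μ (((eigenvalueSet X : Set ℂ) \ {μ}) ∪ Complex.slitPlaneᶜ) / 3

/-- The holomorphic functional calculus `f(X) = (2πi)⁻¹ ∮_γ f(z) (z - X)⁻¹ dz` for functions `f`
holomorphic on `ℂ \ (-∞, 0]`.  The contour `γ`, which encloses the spectrum of `X` and avoids
`(-∞, 0]`, consists of one positively oriented circle around each eigenvalue of `X`.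
The integral of a matrix-valued function is taken entry by entry. -/
def holomorphicCalculus {n : ℕ} (f : ℂ → ℂ) (X : Matrix (Fin n) (Fin n) ℂ) :
    Matrix (Fin n) (Fin n) ℂ :=
  Matrix.of fun i j =>
    (2 * (Real.pi : ℂ) * Complex.I)⁻¹ *
      ∑ μ ∈ eigenvalueSet X,
        ∮ z in C(μ, contourRadius X μ),
          f z * ((z • (1 : Matrix (Fin n) (Fin n) ℂ) - X)⁻¹) i j

/-- The principal square root `X^{1/2}`: the principal branch of the scalar square root, applied
to `X` through the holomorphic functional calculus. -/
def principalSqrt {n : ℕ} (X : Matrix (Fin n) (Fin n) ℂ) : Matrix (Fin n) (Fin n) ℂ :=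
  holomorphicCalculus (fun z => z ^ (1 / 2 : ℂ)) X

/-- The matrix `Z = [[0, I], [-I, 0]]` of even size `n = m + m`, with blocks of size `m`. -/
def skewZ {m n : ℕ} (h : m + m = n) : Matrix (Fin n) (Fin n) ℂ :=
  Matrix.reindex (finSumFinEquiv.trans (finCongr h)) (finSumFinEquiv.trans (finCongr h))
    (Matrix.fromBlocks (0 : Matrix (Fin m) (Fin m) ℂ) 1 (-1) 0)

/-- The dual operation `X♯ = -Z Xᵀ Z` on matrices of even size. -/
def dual {m n : ℕ} (h : m + m = n) (X : Matrix (Fin n) (Fin n) ℂ) : Matrix (Fin n) (Fin n) ℂ :=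
  -(skewZ h * X.transpose * skewZ h)

/-- `X` is self-dual if `X♯ = X`. -/
def IsSelfDual {m n : ℕ} (h : m + m = n) (X : Matrix (Fin n) (Fin n) ℂ) : Prop :=
  dual h X = X

/-- All entries of `X` are real. -/
def IsRealMatrix {n : ℕ} (X : Matrix (Fin n) (Fin n) ℂ) : Prop :=
  ∀ i j, (X i j).im = 0

end RootSymmetry

end

open Matrix ComplexConjugate

namespace RootSymmetry

variable {n : ℕ}

/-! The contour is built from the spectrum alone, so the calculus inherits the symmetries of the
resolvent. It commutes with transposition and with similarity (`holomorphicCalculus_transpose`,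
`holomorphicCalculus_conj`). If `f` commutes with conjugation on the slit plane, it also commutes
with entrywise conjugation (`holomorphicCalculus_map_conj`). Claims 2-5 follow by applying these to
the equation that expresses the symmetry of `X`. For claim 1, `X` is diagonalized by a unitary
matrix. Cauchy's formula evaluates the calculus on the diagonal factor, and the square root maps the
unit circle into itself. -/

theorem mem_eigenvalueSet_iff_det {X : Matrix (Fin n) (Fin n) ℂ} {z : ℂ} :
    z ∈ eigenvalueSet X ↔ (z • (1 : Matrix (Fin n) (Fin n) ℂ) - X).det = 0 := by
  rw [eigenvalueSet, Multiset.mem_toFinset, Polynomial.mem_roots (charpoly_monic X).ne_zero,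
    Polynomial.IsRoot.def, eval_charpoly, scalar_apply, smul_one_eq_diagonal]

theorem NoNonposEigenvalue.mem_slitPlane {X : Matrix (Fin n) (Fin n) ℂ}
    (hX : NoNonposEigenvalue X) {z : ℂ} (hz : z ∈ eigenvalueSet X) : z ∈ Complex.slitPlane := by
  by_contra h
  rw [Complex.mem_slitPlane_iff, not_or, not_lt, not_not] at h
  have hz' : ((z.re : ℝ) : ℂ) = z := Complex.ext rfl (by simp [h.2])
  refine hX z.re h.1 ?_
  rw [hz', Module.End.hasEigenvalue_iff_isRoot_charpoly, Matrix.charpoly_toLin']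
  rw [eigenvalueSet, Multiset.mem_toFinset] at hz
  exact Polynomial.isRoot_of_mem_roots hz

theorem noNonposEigenvalue_of_subset_slitPlane {X : Matrix (Fin n) (Fin n) ℂ}
    (h : ∀ z ∈ eigenvalueSet X, z ∈ Complex.slitPlane) : NoNonposEigenvalue X := by
  intro t ht hev
  rw [Module.End.hasEigenvalue_iff_isRoot_charpoly, Matrix.charpoly_toLin'] at hev
  have := h t (by
    rw [eigenvalueSet, Multiset.mem_toFinset, Polynomial.mem_roots (charpoly_monic X).ne_zero]
    exact hev)
  rw [Complex.ofReal_mem_slitPlane] at this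
  linarith

theorem NoNonposEigenvalue.of_eigenvalueSet_eq {X Y : Matrix (Fin n) (Fin n) ℂ}
    (hX : NoNonposEigenvalue X) (h : eigenvalueSet Y = eigenvalueSet X) : NoNonposEigenvalue Y :=
  noNonposEigenvalue_of_subset_slitPlane fun _ hz => hX.mem_slitPlane (h ▸ hz)

/-! ### Geometry of the contour -/

theorem contourRadius_nonneg (X : Matrix (Fin n) (Fin n) ℂ) (μ : ℂ) : 0 ≤ contourRadius X μ :=
  div_nonneg Metric.infDist_nonneg (by norm_num)

theorem contourRadius_pos {X : Matrix (Fin n) (Fin n) ℂ} {μ : ℂ} (hμ : μ ∈ Complex.slitPlane) :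
    0 < contourRadius X μ := by
  have hcl : IsClosed (((eigenvalueSet X : Set ℂ) \ {μ}) ∪ Complex.slitPlaneᶜ) :=
    ((eigenvalueSet X).finite_toSet.subset Set.sdiff_subset).isClosed.union
      Complex.isOpen_slitPlane.isClosed_compl
  -- `Metric.infDist` to the empty set is 0, so nonemptiness matters; the point 0 of the cut
  -- provides it.
  have hne : (((eigenvalueSet X : Set ℂ) \ {μ}) ∪ Complex.slitPlaneᶜ).Nonempty :=
    ⟨0, Or.inr Complex.zero_notMem_slitPlane⟩
  refine div_pos ((hcl.notMem_iff_infDist_pos hne).1 ?_) (by norm_num)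
  rintro (h | h)
  · exact h.2 rfl
  · exact h hμ

theorem notMem_of_mem_closedBall_contourRadius {X : Matrix (Fin n) (Fin n) ℂ} {μ z : ℂ}
    (hμ : μ ∈ Complex.slitPlane) (hz : z ∈ Metric.closedBall μ (contourRadius X μ)) :
    z ∉ ((eigenvalueSet X : Set ℂ) \ {μ}) ∪ Complex.slitPlaneᶜ := by
  intro h
  have h1 := Metric.infDist_le_dist_of_mem (x := μ) h
  have h2 := contourRadius_pos (X := X) hμ
  rw [Metric.mem_closedBall, dist_comm] at hz
  unfold contourRadius at hz h2
  linarith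

theorem closedBall_contourRadius_subset_slitPlane {X : Matrix (Fin n) (Fin n) ℂ} {μ : ℂ}
    (hμ : μ ∈ Complex.slitPlane) :
    Metric.closedBall μ (contourRadius X μ) ⊆ Complex.slitPlane := fun _ hz => by
  by_contra h
  exact notMem_of_mem_closedBall_contourRadius hμ hz (Or.inr h)

theorem eq_center_of_mem_closedBall {X : Matrix (Fin n) (Fin n) ℂ} {μ z : ℂ}
    (hμ : μ ∈ Complex.slitPlane) (hz : z ∈ Metric.closedBall μ (contourRadius X μ))
    (hzX : z ∈ eigenvalueSet X) : z = μ := by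
  by_contra h
  exact notMem_of_mem_closedBall_contourRadius hμ hz (Or.inl ⟨hzX, h⟩)

theorem notMem_eigenvalueSet_of_mem_sphere {X : Matrix (Fin n) (Fin n) ℂ} {μ z : ℂ}
    (hμ : μ ∈ Complex.slitPlane) (hz : z ∈ Metric.sphere μ (contourRadius X μ)) :
    z ∉ eigenvalueSet X := by
  intro h
  have h1 := eq_center_of_mem_closedBall hμ (Metric.sphere_subset_closedBall hz) h
  have h2 := contourRadius_pos (X := X) hμ
  rw [h1, Metric.mem_sphere, dist_self] at hz
  linarith

theorem contourRadius_congr {X Y : Matrix (Fin n) (Fin n) ℂ}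
    (h : eigenvalueSet Y = eigenvalueSet X) (μ : ℂ) : contourRadius Y μ = contourRadius X μ := by
  rw [contourRadius, contourRadius, h]

theorem circleIntegrable_resolvent {f : ℂ → ℂ} (hf : ContinuousOn f Complex.slitPlane)
    (X : Matrix (Fin n) (Fin n) ℂ) {μ : ℂ} (hμ : μ ∈ Complex.slitPlane) (i j : Fin n) :
    CircleIntegrable (fun z => f z * ((z • (1 : Matrix (Fin n) (Fin n) ℂ) - X)⁻¹) i j) μ
      (contourRadius X μ) := by
  apply ContinuousOn.circleIntegrable (contourRadius_nonneg X μ)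
  refine (hf.mono (Metric.sphere_subset_closedBall.trans
    (closedBall_contourRadius_subset_slitPlane hμ))).mul ?_
  have hc : Continuous fun z : ℂ => z • (1 : Matrix (Fin n) (Fin n) ℂ) - X := by fun_prop
  simp only [inv_def, Ring.inverse_eq_inv', Matrix.smul_apply, smul_eq_mul]
  refine ContinuousOn.mul (hc.matrix_det.continuousOn.inv₀ fun z hz => ?_)
    (hc.matrix_adjugate.matrix_elem i j).continuousOn
  exact fun h => notMem_eigenvalueSet_of_mem_sphere hμ hz (mem_eigenvalueSet_iff_det.2 h)

/-! ### Transposition and similarity -/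

theorem eigenvalueSet_transpose (X : Matrix (Fin n) (Fin n) ℂ) :
    eigenvalueSet Xᵀ = eigenvalueSet X := by
  rw [eigenvalueSet, charpoly_transpose, eigenvalueSet]

theorem holomorphicCalculus_transpose (f : ℂ → ℂ) (X : Matrix (Fin n) (Fin n) ℂ) :
    holomorphicCalculus f Xᵀ = (holomorphicCalculus f X)ᵀ := by
  ext i j
  simp only [holomorphicCalculus, of_apply, transpose_apply, eigenvalueSet_transpose,
    contourRadius_congr (eigenvalueSet_transpose X)]
  congr 1
  refine Finset.sum_congr rfl fun μ _ => ?_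
  congr 1
  ext z
  have : z • (1 : Matrix (Fin n) (Fin n) ℂ) - Xᵀ = (z • (1 : Matrix (Fin n) (Fin n) ℂ) - X)ᵀ := by
    simp
  rw [this, ← transpose_nonsing_inv, transpose_apply]

theorem smul_one_sub_conj {P Q : Matrix (Fin n) (Fin n) ℂ} (hPQ : P * Q = 1)
    (X : Matrix (Fin n) (Fin n) ℂ) (z : ℂ) :
    z • (1 : Matrix (Fin n) (Fin n) ℂ) - P * X * Q =
      P * (z • (1 : Matrix (Fin n) (Fin n) ℂ) - X) * Q := by
  rw [mul_sub, sub_mul, mul_smul_comm, smul_mul_assoc, mul_one, hPQ]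

theorem eigenvalueSet_conj {P Q : Matrix (Fin n) (Fin n) ℂ} (hPQ : P * Q = 1)
    (X : Matrix (Fin n) (Fin n) ℂ) : eigenvalueSet (P * X * Q) = eigenvalueSet X := by
  have h : P.det * Q.det = 1 := by rw [← det_mul, hPQ, det_one]
  ext z
  rw [mem_eigenvalueSet_iff_det, mem_eigenvalueSet_iff_det, smul_one_sub_conj hPQ, det_mul,
    det_mul, mul_right_comm, h, one_mul]

/-- Each entry of the conjugated resolvent is a fixed linear combination of resolvent entries. The
spectral hypothesis makes these integrable on the circles, so the integral splits. -/
theorem holomorphicCalculus_conj {f : ℂ → ℂ} (hf : ContinuousOn f Complex.slitPlane)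
    {P Q : Matrix (Fin n) (Fin n) ℂ} (hPQ : P * Q = 1) {X : Matrix (Fin n) (Fin n) ℂ}
    (hX : NoNonposEigenvalue X) :
    holomorphicCalculus f (P * X * Q) = P * holomorphicCalculus f X * Q := by
  have hP : P⁻¹ = Q := inv_eq_right_inv hPQ
  have hQ : Q⁻¹ = P := inv_eq_left_inv hPQ
  ext i j
  have hint (μ : ℂ) (hμ : μ ∈ eigenvalueSet X) :
      (∮ z in C(μ, contourRadius X μ),
        f z * ((z • (1 : Matrix (Fin n) (Fin n) ℂ) - P * X * Q)⁻¹) i j) =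
      ∑ l, ∑ k, P i k * (∮ z in C(μ, contourRadius X μ),
        f z * ((z • (1 : Matrix (Fin n) (Fin n) ℂ) - X)⁻¹) k l) * Q l j := by
    have hI := circleIntegrable_resolvent hf X (hX.mem_slitPlane hμ)
    have hI' (k l : Fin n) : CircleIntegrable (fun z => P i k * Q l j *
        (f z * ((z • (1 : Matrix (Fin n) (Fin n) ℂ) - X)⁻¹) k l)) μ (contourRadius X μ) :=
      (hI k l).const_smul (a := P i k * Q l j)
    have hexp : (fun z => f z * ((z • (1 : Matrix (Fin n) (Fin n) ℂ) - P * X * Q)⁻¹) i j) =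
        fun z => ∑ l, ∑ k, P i k * Q l j *
          (f z * ((z • (1 : Matrix (Fin n) (Fin n) ℂ) - X)⁻¹) k l) := by
      ext z
      rw [smul_one_sub_conj hPQ, Matrix.mul_inv_rev, Matrix.mul_inv_rev, hP, hQ, ← mul_assoc, mul_apply,
        Finset.mul_sum]
      refine Finset.sum_congr rfl fun l _ => ?_
      rw [mul_apply, Finset.sum_mul, Finset.mul_sum]
      exact Finset.sum_congr rfl fun k _ => by ring
    rw [hexp, circleIntegral.integral_fun_sum fun l _ => CircleIntegrable.fun_sum _
      fun k _ => hI' k l]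
    refine Finset.sum_congr rfl fun l _ => ?_
    rw [circleIntegral.integral_fun_sum fun k _ => hI' k l]
    refine Finset.sum_congr rfl fun k _ => ?_
    rw [circleIntegral.integral_const_mul]
    ring
  simp only [holomorphicCalculus, of_apply, mul_apply, eigenvalueSet_conj hPQ,
    contourRadius_congr (eigenvalueSet_conj hPQ X)]
  rw [Finset.sum_congr rfl hint, Finset.sum_comm, Finset.mul_sum]
  refine Finset.sum_congr rfl fun l _ => ?_
  rw [Finset.sum_comm, Finset.sum_mul, Finset.mul_sum]
  refine Finset.sum_congr rfl fun k _ => ?_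
  rw [← Finset.sum_mul, ← Finset.mul_sum]
  ring

/-! ### Complex conjugation -/

/-- Reflection in the real axis reverses the orientation of the circle, whence the sign; in the
parameter it is `θ ↦ 2π - θ`. -/
theorem conj_circleIntegral (g : ℂ → ℂ) (c : ℂ) (r : ℝ) :
    conj (∮ z in C(c, r), g z) = -∮ z in C(conj c, r), conj (g (conj z)) := by
  have key (θ : ℝ) : circleMap (conj c) r (2 * Real.pi - θ) = conj (circleMap c r θ) := by
    simp only [circleMap, map_add, map_mul, Complex.conj_ofReal, ← Complex.exp_conj, Complex.conj_I]
    congr 2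
    push_cast
    rw [show (2 * (Real.pi : ℂ) - θ) * Complex.I = θ * -Complex.I + 2 * Real.pi * Complex.I by ring,
      Complex.exp_periodic]
  have key0 (θ : ℝ) : circleMap 0 r (2 * Real.pi - θ) = conj (circleMap 0 r θ) := by
    have := key θ
    simp only [circleMap, map_add, add_right_inj] at this ⊢
    rw [map_zero, this]
  have h := intervalIntegral.integral_comp_sub_left (a := 0) (b := 2 * Real.pi)
    (fun θ : ℝ => deriv (circleMap (conj c) r) θ • conj (g (conj (circleMap (conj c) r θ))))
    (2 * Real.pi)
  rw [sub_self, sub_zero] at h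
  rw [circleIntegral, circleIntegral, ← h, ← intervalIntegral.integral_neg,
    intervalIntegral.integral_of_le Real.two_pi_pos.le,
    intervalIntegral.integral_of_le Real.two_pi_pos.le, ← integral_conj]
  congr 1
  ext θ
  simp [key, key0]

theorem smul_one_sub_map_conj (X : Matrix (Fin n) (Fin n) ℂ) (z : ℂ) :
    conj z • (1 : Matrix (Fin n) (Fin n) ℂ) - X.map conj =
      (z • (1 : Matrix (Fin n) (Fin n) ℂ) - X).map conj := by
  ext i j
  by_cases h : i = j <;> simp [h]

theorem conj_mem_eigenvalueSet_map_conj {X : Matrix (Fin n) (Fin n) ℂ} {z : ℂ} :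
    conj z ∈ eigenvalueSet (X.map conj) ↔ z ∈ eigenvalueSet X := by
  rw [mem_eigenvalueSet_iff_det, mem_eigenvalueSet_iff_det, smul_one_sub_map_conj,
    ← RingHom.mapMatrix_apply, ← RingHom.map_det, map_eq_zero]

theorem eigenvalueSet_map_conj (X : Matrix (Fin n) (Fin n) ℂ) :
    eigenvalueSet (X.map conj) = (eigenvalueSet X).image conj := by
  ext z
  obtain ⟨w, rfl⟩ : ∃ w, conj w = z := ⟨conj z, Complex.conj_conj z⟩
  rw [conj_mem_eigenvalueSet_map_conj,
    (starRingEnd ℂ).injective.mem_finset_image]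

theorem conj_mem_slitPlane {z : ℂ} : conj z ∈ Complex.slitPlane ↔ z ∈ Complex.slitPlane := by
  simp [Complex.mem_slitPlane_iff]

/-- Conjugation is an isometry preserving both the cut and, up to reflection, the spectrum. -/
theorem contourRadius_map_conj (X : Matrix (Fin n) (Fin n) ℂ) (μ : ℂ) :
    contourRadius (X.map conj) (conj μ) = contourRadius X μ := by
  have h : ((eigenvalueSet (X.map conj) : Set ℂ) \ {conj μ}) ∪ Complex.slitPlaneᶜ =
      Complex.conjLIE '' (((eigenvalueSet X : Set ℂ) \ {μ}) ∪ Complex.slitPlaneᶜ) := by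
    ext z
    constructor
    · intro hz
      obtain ⟨w, rfl⟩ : ∃ w, conj w = z := ⟨conj z, Complex.conj_conj z⟩
      refine ⟨w, ?_, rfl⟩
      simpa [conj_mem_eigenvalueSet_map_conj, conj_mem_slitPlane,
        (starRingEnd ℂ).injective.eq_iff] using hz
    · rintro ⟨w, hw, rfl⟩
      simpa [conj_mem_eigenvalueSet_map_conj, conj_mem_slitPlane,
        (starRingEnd ℂ).injective.eq_iff] using hw
  rw [contourRadius, contourRadius, h]
  congr 1
  exact Metric.infDist_image Complex.conjLIE.isometry

theorem inv_map_conj (A : Matrix (Fin n) (Fin n) ℂ) : (A.map conj)⁻¹ = A⁻¹.map conj := by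
  have h : A.map conj = (Aᴴ)ᵀ := by ext; simp
  rw [h, ← transpose_nonsing_inv, ← conjTranspose_nonsing_inv]
  ext; simp

theorem holomorphicCalculus_map_conj {f : ℂ → ℂ}
    (hf : ∀ z ∈ Complex.slitPlane, f (conj z) = conj (f z)) {X : Matrix (Fin n) (Fin n) ℂ}
    (hX : NoNonposEigenvalue X) :
    holomorphicCalculus f (X.map conj) = (holomorphicCalculus f X).map conj := by
  ext i j
  simp only [holomorphicCalculus, of_apply, map_apply, eigenvalueSet_map_conj]
  rw [Finset.sum_image (starRingEnd ℂ).injective.injOn, map_mul, map_sum]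
  -- This sign, from conjugating `I`, cancels the orientation reversal in `conj_circleIntegral`.
  have hc : conj ((2 * (Real.pi : ℂ) * Complex.I)⁻¹) = -(2 * (Real.pi : ℂ) * Complex.I)⁻¹ := by
    simp [map_ofNat]
  rw [hc, neg_mul, ← mul_neg, ← Finset.sum_neg_distrib]
  congr 1
  refine Finset.sum_congr rfl fun μ hμ => ?_
  rw [contourRadius_map_conj, conj_circleIntegral, neg_neg]
  refine circleIntegral.integral_congr (contourRadius_nonneg X μ) fun z hz => ?_
  have hz' : conj z ∈ Complex.slitPlane := by
    refine closedBall_contourRadius_subset_slitPlane (X := X) (hX.mem_slitPlane hμ)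
      (Metric.sphere_subset_closedBall ?_)
    rw [mem_sphere_iff_norm] at hz ⊢
    rw [← hz, ← Complex.norm_conj (z - _)]
    simp
  have h1 := hf _ hz'
  have h2 := smul_one_sub_map_conj X (conj z)
  rw [Complex.conj_conj] at h1 h2
  simp only [h1, h2, inv_map_conj, map_apply, map_mul]

theorem holomorphicCalculus_conjTranspose {f : ℂ → ℂ}
    (hf : ∀ z ∈ Complex.slitPlane, f (conj z) = conj (f z)) {X : Matrix (Fin n) (Fin n) ℂ}
    (hX : NoNonposEigenvalue X) :
    holomorphicCalculus f Xᴴ = (holomorphicCalculus f X)ᴴ := by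
  have h (A : Matrix (Fin n) (Fin n) ℂ) : Aᴴ = (A.map conj)ᵀ := by ext; simp
  rw [h, holomorphicCalculus_transpose, holomorphicCalculus_map_conj hf hX, ← h]

/-! ### Diagonal and unitary matrices -/

/-- On the diagonal, Cauchy's formula on the circle around `d i` gives `f (d i)`; the other circles
do not enclose `d i` and contribute zero. -/
theorem holomorphicCalculus_diagonal {f : ℂ → ℂ} (hf : DifferentiableOn ℂ f Complex.slitPlane)
    {d : Fin n → ℂ} (hd : NoNonposEigenvalue (diagonal d)) :
    holomorphicCalculus f (diagonal d) = diagonal (f ∘ d) := by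
  have hmem (i : Fin n) : d i ∈ eigenvalueSet (diagonal d) := by
    rw [mem_eigenvalueSet_iff_det, smul_one_eq_diagonal, diagonal_sub, det_diagonal]
    exact Finset.prod_eq_zero (Finset.mem_univ i) (sub_self _)
  have hinv {z : ℂ} (hz : z ∉ eigenvalueSet (diagonal d)) :
      (z • (1 : Matrix (Fin n) (Fin n) ℂ) - diagonal d)⁻¹ = diagonal fun i => (z - d i)⁻¹ := by
    apply inv_eq_right_inv
    rw [smul_one_eq_diagonal, diagonal_sub, diagonal_mul_diagonal, ← diagonal_one]
    congr 1
    ext i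
    exact mul_inv_cancel₀ (sub_ne_zero.2 fun h => hz (h ▸ hmem i))
  have hint (i j : Fin n) (μ : ℂ) (hμ : μ ∈ eigenvalueSet (diagonal d)) :
      (∮ z in C(μ, contourRadius (diagonal d) μ),
        f z * ((z • (1 : Matrix (Fin n) (Fin n) ℂ) - diagonal d)⁻¹) i j) =
      ∮ z in C(μ, contourRadius (diagonal d) μ),
        f z * (diagonal fun i => (z - d i)⁻¹ : Matrix (Fin n) (Fin n) ℂ) i j :=
    circleIntegral.integral_congr (contourRadius_nonneg _ _) fun z hz => by
      simp only [hinv (notMem_eigenvalueSet_of_mem_sphere (hd.mem_slitPlane hμ) hz)]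
  ext i j
  rw [holomorphicCalculus, of_apply, Finset.sum_congr rfl (hint i j)]
  by_cases hij : i = j
  swap
  · simp [hij, circleIntegral]
  subst hij
  simp only [diagonal_apply_eq, Function.comp_apply]
  rw [Finset.sum_eq_single (d i)]
  · have hs := hd.mem_slitPlane (hmem i)
    have hdiff := hf.mono (closedBall_contourRadius_subset_slitPlane (X := diagonal d) hs)
    have := (hdiff.diffContOnCl_ball subset_rfl).circleIntegral_sub_inv_smul
      (Metric.mem_ball_self (contourRadius_pos hs))
    simp only [smul_eq_mul, mul_comm _ (f _)] at this
    rw [this, mul_comm (f _), inv_mul_cancel_left₀ Complex.two_pi_I_ne_zero]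
  · intro μ hμ hne
    have hs := hd.mem_slitPlane hμ
    have hdiff := hf.mono (closedBall_contourRadius_subset_slitPlane (X := diagonal d) hs)
    have hdiff' : DifferentiableOn ℂ (fun z => f z * (z - d i)⁻¹)
        (Metric.closedBall μ (contourRadius (diagonal d) μ)) :=
      hdiff.mul ((differentiableOn_id.sub_const _).inv fun z hz => sub_ne_zero.2 fun h =>
        hne (eq_center_of_mem_closedBall hs (h ▸ hz) (hmem i)).symm)
    exact (hdiff'.diffContOnCl_ball subset_rfl).circleIntegral_eq_zero (contourRadius_nonneg _ _)
  · exact fun h => absurd (hmem i) h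

/-- The Cayley transform `H = i(1 - X)(1 + X)⁻¹` is Hermitian. The spectral theorem diagonalizes it,
and inverting the transform diagonalizes `X` in the same basis. -/
theorem exists_unitary_diagonalization {X : Matrix (Fin n) (Fin n) ℂ}
    (hX : X ∈ unitaryGroup (Fin n) ℂ) (h1 : IsUnit (1 + X).det) :
    ∃ U ∈ unitaryGroup (Fin n) ℂ, ∃ d : Fin n → ℂ, X = U * diagonal d * star U := by
  have hXs : star X * X = 1 := hX.1
  set V := (1 + X)⁻¹
  have hV : (1 + X) * V = 1 := mul_nonsing_inv _ h1
  have hVs : star V * (1 + star X) = 1 := by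
    simpa using congrArg star hV
  set H := Complex.I • ((1 - X) * V) with hHdef
  have hH : H.IsHermitian := by
    have e : -((1 - star X) * (1 + X)) = (1 + star X) * (1 - X) := by
      simp only [sub_mul, mul_add, add_mul, mul_sub, hXs]; simp; abel
    have e2 : -(star V * (1 - star X)) = (1 - X) * V := by
      calc -(star V * (1 - star X)) = star V * (-((1 - star X) * (1 + X))) * V := by
            rw [mul_neg, neg_mul, ← mul_assoc, mul_assoc _ _ V, hV, mul_one]
        _ = (1 - X) * V := by rw [e, ← mul_assoc, hVs, one_mul]
    rw [IsHermitian, ← star_eq_conjTranspose, hHdef, star_smul, star_mul, star_sub, star_one, ← e2]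
    simp
  set U : Matrix (Fin n) (Fin n) ℂ := hH.eigenvectorUnitary.1
  have hU : U ∈ unitaryGroup (Fin n) ℂ := hH.eigenvectorUnitary.2
  have hUs : star U * U = 1 := hU.1
  have hUs' : U * star U = 1 := hU.2
  set e : Fin n → ℂ := fun i => hH.eigenvalues i with he
  have hspec : H = U * diagonal e * star U := hH.spectral_theorem
  -- The eigenvalues of `H` are real, so this number has real part 1.
  have hne (i : Fin n) : 1 - Complex.I * e i ≠ 0 := fun h => by
    have := congrArg Complex.re h
    simp [he] at this
  have hXH : X * (1 - Complex.I • H) = 1 + Complex.I • H := by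
    have h2 : Complex.I • H = -((1 - X) * V) := by
      rw [hHdef, smul_smul, Complex.I_mul_I, neg_one_smul]
    have h3 : (1 - Complex.I • H) = (2 : ℂ) • V := by
      calc 1 - Complex.I • H = (1 + X) * V + (1 - X) * V := by rw [h2, hV, sub_neg_eq_add]
        _ = (2 : ℂ) • V := by rw [two_smul]; noncomm_ring
    have h4 : (1 + Complex.I • H) = (2 : ℂ) • (X * V) := by
      calc 1 + Complex.I • H = (1 + X) * V - (1 - X) * V := by rw [h2, hV, ← sub_eq_add_neg]
        _ = (2 : ℂ) • (X * V) := by rw [two_smul]; noncomm_ring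
    rw [h3, h4, mul_smul_comm]
  refine ⟨U, hU, fun i => (1 + Complex.I * e i) * (1 - Complex.I * e i)⁻¹, ?_⟩
  have hm : 1 - Complex.I • H = U * (diagonal fun i => 1 - Complex.I * e i) * star U := by
    rw [← diagonal_sub, mul_sub, sub_mul]
    rw [show (diagonal fun _ => 1 : Matrix (Fin n) (Fin n) ℂ) = 1 from diagonal_one, mul_one, hUs',
      hspec, ← smul_mul_assoc, ← mul_smul_comm, ← diagonal_smul]
    rfl
  have hp : 1 + Complex.I • H = U * (diagonal fun i => 1 + Complex.I * e i) * star U := by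
    rw [← diagonal_add, mul_add, add_mul]
    rw [show (diagonal fun _ => 1 : Matrix (Fin n) (Fin n) ℂ) = 1 from diagonal_one, mul_one, hUs',
      hspec, ← smul_mul_assoc, ← mul_smul_comm, ← diagonal_smul]
    rfl
  have hinv : (diagonal fun i => 1 - Complex.I * e i) *
      (diagonal fun i => (1 - Complex.I * e i)⁻¹) = (1 : Matrix (Fin n) (Fin n) ℂ) := by
    rw [diagonal_mul_diagonal, ← diagonal_one]
    congr 1
    ext i
    exact mul_inv_cancel₀ (hne i)
  rw [hm, hp] at hXH
  set A : Matrix (Fin n) (Fin n) ℂ := diagonal fun i => 1 - Complex.I * e i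
  set B : Matrix (Fin n) (Fin n) ℂ := diagonal fun i => (1 - Complex.I * e i)⁻¹
  have hk : U * A * star U * (U * B * star U) = 1 := by
    rw [show U * A * star U * (U * B * star U) = U * A * (star U * U) * B * star U by noncomm_ring,
      hUs, mul_one, mul_assoc U, hinv, mul_one, hUs']
  calc X = X * (U * A * star U) * (U * B * star U) := by rw [mul_assoc, hk, mul_one]
    _ = U * (diagonal fun i => 1 + Complex.I * e i) * (star U * U) * B * star U := by
      rw [hXH]; noncomm_ring
    _ = _ := by rw [hUs, mul_one, mul_assoc U, diagonal_mul_diagonal]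

theorem holomorphicCalculus_mem_unitaryGroup {f : ℂ → ℂ}
    (hf : DifferentiableOn ℂ f Complex.slitPlane) (hf1 : ∀ z : ℂ, ‖z‖ = 1 → ‖f z‖ = 1)
    {X : Matrix (Fin n) (Fin n) ℂ} (hX : NoNonposEigenvalue X)
    (hXu : X ∈ unitaryGroup (Fin n) ℂ) :
    holomorphicCalculus f X ∈ unitaryGroup (Fin n) ℂ := by
  have h1 : IsUnit (1 + X).det := by
    rw [isUnit_iff_ne_zero]
    intro h
    -- The Cayley transform needs -1 to be no eigenvalue; -1 lies on the excluded cut.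
    have hm : (-1 : ℂ) ∈ eigenvalueSet X := by
      rw [mem_eigenvalueSet_iff_det, show (-1 : ℂ) • (1 : Matrix (Fin n) (Fin n) ℂ) - X = -(1 + X) by
        rw [neg_one_smul, neg_add']]
      rw [det_neg, h, mul_zero]
    have := hX.mem_slitPlane hm
    norm_num [Complex.mem_slitPlane_iff] at this
  obtain ⟨U, hU, d, rfl⟩ := exists_unitary_diagonalization hXu h1
  have hd : NoNonposEigenvalue (diagonal d) :=
    hX.of_eigenvalueSet_eq (eigenvalueSet_conj hU.2 _).symm
  have hdu : diagonal d ∈ unitaryGroup (Fin n) ℂ := by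
    have := mul_mem (mul_mem (Unitary.star_mem hU) hXu) hU
    have e : star U * (U * diagonal d * star U) * U =
      (star U * U) * diagonal d * (star U * U) := by noncomm_ring
    have h3 : star U * U = 1 := hU.1
    rwa [e, h3, one_mul, mul_one] at this
  have hd1 (i : Fin n) : ‖d i‖ = 1 := by
    have := congrFun (congrFun (mem_unitaryGroup_iff.1 hdu) i) i
    rw [star_eq_conjTranspose, diagonal_conjTranspose, diagonal_mul_diagonal, diagonal_apply_eq,
      one_apply_eq, Pi.star_apply, ← starRingEnd_apply, Complex.mul_conj'] at this
    exact (pow_eq_one_iff_of_nonneg (norm_nonneg _) two_ne_zero).1 (by exact_mod_cast this)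
  rw [holomorphicCalculus_conj hf.continuousOn hU.2 hd, holomorphicCalculus_diagonal hf hd]
  refine mul_mem (mul_mem hU ?_) (Unitary.star_mem hU)
  rw [mem_unitaryGroup_iff, star_eq_conjTranspose, diagonal_conjTranspose, diagonal_mul_diagonal,
    ← diagonal_one]
  congr 1
  ext i
  rw [Pi.star_apply, ← starRingEnd_apply, Complex.mul_conj', Function.comp_apply, hf1 _ (hd1 i)]
  simp

/-! ### The principal square root and the skew form -/

theorem differentiableOn_cpow_half :
    DifferentiableOn ℂ (fun z : ℂ => z ^ (1 / 2 : ℂ)) Complex.slitPlane :=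
  differentiableOn_id.cpow_const fun _ hz => hz

theorem conj_cpow_half {z : ℂ} (hz : z ∈ Complex.slitPlane) :
    conj z ^ (1 / 2 : ℂ) = conj (z ^ (1 / 2 : ℂ)) := by
  rw [Complex.conj_cpow _ _ (Complex.slitPlane_arg_ne_pi hz)]
  simp [map_ofNat]

theorem norm_cpow_half {z : ℂ} (hz : ‖z‖ = 1) : ‖z ^ (1 / 2 : ℂ)‖ = 1 := by
  have h : (z ^ (1 / 2 : ℂ)) ^ 2 = z := by
    rw [one_div]; exact Complex.cpow_nat_inv_pow z two_ne_zero
  rw [← pow_eq_one_iff_of_nonneg (norm_nonneg _) two_ne_zero, ← norm_pow, h, hz]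

theorem skewZ_mul_skewZ {m : ℕ} (h : m + m = n) : skewZ h * skewZ h = -1 := by
  rw [skewZ, reindex_apply, submatrix_mul_equiv, fromBlocks_multiply]
  have : (fromBlocks (0 * 0 + 1 * -1) (0 * 1 + 1 * 0) (-1 * 0 + 0 * -1) (-1 * 1 + 0 * 0) :
      Matrix (Fin m ⊕ Fin m) (Fin m ⊕ Fin m) ℂ) = -1 := by
    rw [← fromBlocks_one, fromBlocks_neg]; simp
  rw [this, submatrix_neg, Pi.neg_apply, Pi.neg_apply, submatrix_one_equiv]

end RootSymmetry

open RootSymmetry in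
theorem mainTheorem6 (n : ℕ) (X R : Matrix (Fin n) (Fin n) ℂ)
    (hX : RootSymmetry.NoNonposEigenvalue X)
    (hR : R = RootSymmetry.principalSqrt X) :
    (X ∈ Matrix.unitaryGroup (Fin n) ℂ → R ∈ Matrix.unitaryGroup (Fin n) ℂ) ∧
    (X.IsSymm → R.IsSymm) ∧
    (RootSymmetry.IsRealMatrix X → RootSymmetry.IsRealMatrix R) ∧
    (∀ (m : ℕ) (h : m + m = n),
      RootSymmetry.IsSelfDual h X → RootSymmetry.IsSelfDual h R) ∧
    (∀ Γ : Matrix (Fin n) (Fin n) ℂ,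
      Γ ∈ Matrix.unitaryGroup (Fin n) ℂ → Γ * Γ = 1 →
        Γ * X * Γ = X.conjTranspose → Γ * R * Γ = R.conjTranspose) := by
  subst hR
  have hc := differentiableOn_cpow_half.continuousOn
  refine ⟨holomorphicCalculus_mem_unitaryGroup differentiableOn_cpow_half
    (fun _ => norm_cpow_half) hX, fun h => ?_, fun h i j => ?_, fun m h hd => ?_,
    fun Γ _ hΓ h => ?_⟩
  · rw [Matrix.IsSymm, principalSqrt, ← holomorphicCalculus_transpose, h.eq]
  · have hreal : X.map conj = X := by
      ext i j
      exact Complex.conj_eq_iff_im.2 (h i j)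
    have := holomorphicCalculus_map_conj (f := fun z => z ^ (1 / 2 : ℂ))
      (fun _ => conj_cpow_half) hX
    rw [hreal] at this
    exact Complex.conj_eq_iff_im.1 (congrFun (congrFun this i) j).symm
  -- Since `-Z` and `Z` are mutually inverse, the dual is a similarity applied to the transpose.
  · have hZ : -skewZ h * skewZ h = 1 := by rw [neg_mul, skewZ_mul_skewZ, neg_neg]
    have e (A : Matrix (Fin n) (Fin n) ℂ) : dual h A = -skewZ h * Aᵀ * skewZ h := by
      rw [dual, neg_mul, neg_mul]
    rw [IsSelfDual, e] at hd ⊢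
    rw [principalSqrt, ← holomorphicCalculus_transpose, ← holomorphicCalculus_conj hc hZ
      (hX.of_eigenvalueSet_eq (eigenvalueSet_transpose X)), hd]
  -- `Γ * Γ = 1` alone makes `X ↦ Γ * X * Γ` a similarity.
  · rw [principalSqrt, ← holomorphicCalculus_conj hc hΓ hX, h,
      holomorphicCalculus_conjTranspose (fun _ => conj_cpow_half) hX]
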